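/- Let $P\in(0,1)$, let $\Lambda'_P\subset\mathbb R^3$ be the lattice generated by $(4,2P,2P)$, $(0,2,0)$, $(0,0,2)$, and let $\widehat X_P=\mathbb R^3/\Lambda'_P$, with coordinates $(T,U_1,U_2)$. An oriented tile is a unit square of the usual square grid that is either empty or carries a directed segment from the midpoint of one side $A$ to the midpoint of a different side $B$, where $A,B\in\{N,S,E,W\}$; this tile is denoted $AB$. Label $\widehat X_P$ as follows. For $T\in[-1,1]$, divide the square $[-1,1]^2$ of points $(U_1,U_2)$ into a $4\times4$ checkerboard by the lines $U_1=u_i$ and $U_2=u_i$ $(i=1,2,3)$, and use a $4\times 4$ symbol matrix $M$ (rows listed from top to bottom, columns from left to right), where * for $-1\le T\le -1+P$: $u=(T,\,1-P,\,2-P+T)$ and $M$ has rows $(0,0,0,W),(N,0,0,0),(0,E,0,0),(0,0,S,0)$; * for $-1+P\le T\le 1-P$: $u=(-1+P,\,T,\,1-P)$ and $M$ has rows $(N,0,0,0),(0,0,E,0),(0,W,0,0),(0,0,0,S)$; * for $1-P\le T\le 1$: $u=(-2+P+T,\,-1+P,\,T)$ and $M$ has rows $(0,N,0,0),(0,0,W,0),(0,0,0,S),(E,0,0,0)$.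 A rectangle at a nonzero entry of $M$ is labelled by the empty tile; any other rectangle is labelled $AB$, where $A$ is the symbol in its row of $M$ and $B$ the symbol in its column. On the translate of $[-1,1]^3$ by $(2,P,P)$ use the translated labelling with all labels reversed ($AB$ replaced by $BA$). These two sets together form a fundamental domain for $\Lambda'_P$, so this divides $\widehat X_P$ into $13$ closed pieces, one for each oriented tile. For an offset $V\in\mathbb R^3$ let $\widehat\Xi_{P,V}:\mathbb R^2\to\widehat X_P$ be the map $$\widehat\Xi_{P,V}(x,y)=(2Px+2y,\;2Px,\;2Px+2Py)+V \mod \Lambda'_P .$$ Call $V$ a good offset for $P$ if $\widehat\Xi_{P,V}$ maps every centre $(m+\tfrac12,n+\tfrac12)$, $m,n\in\mathbb Z$, of a unit square of the grid into the interior of some piece. A tiling (a choice of an oriented tile for every unit square of the grid) is produced by $\widehat\Xi_{P,V}$ if the centre of every square is mapped into the interior of the piece labelled by the tile of that square. A tiling is coherently oriented if, for every two adjacent squares, the tile of one points into the common edge if and only if the tile of the other points out of it, and vice versa (so the common edge is used by both tiles with compatible directions, or by neither). Theorem (Oriented coherence). 1. For every $P\in(0,1)$, almost every $V\in\mathbb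 R^3$ is a good offset for $P$; and for every good offset $V$ the map $\widehat\Xi_{P,V}$ produces exactly one tiling, and this tiling is coherently oriented. 2. If $0<p<q$ are coprime integers with $pq$ even and $P=2p/(p+q)$, then $V=0$ is a good offset for $P$. In particular $\widehat\Xi_P=\widehat\Xi_{P,0}$ then produces a coherently oriented tiling. -/

import Mathlib

open MeasureTheory

noncomputable section

namespace Plaid

/-- The four sides (north, south, east, west) of a unit square. -/
inductive Side where
  | N | S | E | W
  deriving DecidableEq

/-- The `12 + 1` oriented tiles: the empty tile, and for each ordered pair `(a, b)` of distinct
sides the tile whose connector is directed from the midpoint of side `a` to the midpoint of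
side `b`. -/
inductive OrientedTile where
  | empty
  | connector (a b : Side) (h : a ≠ b)

namespace OrientedTile

/-- The tile with the direction of its connector reversed. -/
def reverse : OrientedTile → OrientedTile
  | empty => empty
  | connector a b h => connector b a h.symm

/-- The connector of the tile points into the side `e`, i.e. it ends there. -/
def PointsInto : OrientedTile → Side → Prop
  | empty, _ => False
  | connector _ b _, e => b = e

/-- The connector of the tile points out of the side `e`, i.e. it starts there. -/
def PointsOutOf : OrientedTile → Side → Prop
  | empty, _ => False
  | connector a _ _, e => a = e

end OrientedTile

/-- Side `e` of the tile `t` and side `e'` of the tile `t'` are the common edge of the two tiles.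
The tiles match, with orientations: one points into the common edge exactly when the other
points out of it (so the edge is used by both connectors or by neither). -/
def Match (t : OrientedTile) (e : Side) (t' : OrientedTile) (e' : Side) : Prop :=
  (t.PointsInto e ↔ t'.PointsOutOf e') ∧ (t.PointsOutOf e ↔ t'.PointsInto e')

/-- An assignment of an oriented tile to every unit square `[m, m + 1] × [n, n + 1]` is coherently
oriented if all pairs of adjacent tiles match across their common edge. -/
def CoherentlyOriented (τ : ℤ → ℤ → OrientedTile) : Prop :=
  ∀ m n : ℤ, Match (τ m n) .N (τ m (n + 1)) .S ∧ Match (τ m n) .E (τ (m + 1) n) .W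

/-! ### Checkerboards -/

/-- The end points `-1, u₁, u₂, u₃, 1` of the intervals of the checkerboard. -/
def cut (u : Fin 3 → ℝ) : Fin 5 → ℝ := ![-1, u 0, u 1, u 2, 1]

/-- The closed rectangle of the `4 × 4` checkerboard on `[-1, 1]²` in row `i` (counted from the
top, as in a matrix) and column `j` (counted from the left). -/
def cell (u : Fin 3 → ℝ) (i j : Fin 4) : Set (ℝ × ℝ) :=
  Set.Icc (cut u j.castSucc) (cut u j.succ) ×ˢ
    Set.Icc (cut u i.rev.castSucc) (cut u i.rev.succ)

/-- The label of the rectangle in row `i` and column `j` determined by the symbol matrix `M`: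
the special rectangles (nonzero entries of `M`) carry the empty tile; any other rectangle carries
the connector from the symbol in its row to the symbol in its column. -/
def HasLabel (M : Fin 4 → Fin 4 → Option Side) (i j : Fin 4) : OrientedTile → Prop
  | .empty => M i j ≠ none
  | .connector a b _ => M i j = none ∧ (∃ k, M i k = some a) ∧ (∃ k, M k j = some b)

/-- The union of the rectangles of the checkerboard `(u, M)` that are labelled by `t`. -/
def checkerboard (u : Fin 3 → ℝ) (M : Fin 4 → Fin 4 → Option Side) (t : OrientedTile) :
    Set (ℝ × ℝ) :=
  {z | ∃ i j, HasLabel M i j t ∧ z ∈ cell u i j}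

/-! ### The partition -/

/-- Symbol matrix for `-1 ≤ T ≤ -1 + P`. -/
def M₁ : Fin 4 → Fin 4 → Option Side :=
  ![![none, none, none, some .W],
    ![some .N, none, none, none],
    ![none, some .E, none, none],
    ![none, none, some .S, none]]

/-- Symbol matrix for `-1 + P ≤ T ≤ 1 - P`. -/
def M₂ : Fin 4 → Fin 4 → Option Side :=
  ![![some .N, none, none, none],
    ![none, none, some .E, none],
    ![none, some .W, none, none],
    ![none, none, none, some .S]]

/-- Symbol matrix for `1 - P ≤ T ≤ 1`. -/
def M₃ : Fin 4 → Fin 4 → Option Side :=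
  ![![none, some .N, none, none],
    ![none, none, some .W, none],
    ![none, none, none, some .S],
    ![some .E, none, none, none]]

/-- The part of `[-1, 1]³`, with coordinates `(T, U₁, U₂)`, that is labelled by the tile `t`:
the fibre over `T` carries a checkerboard depending on `P` and `T`. -/
def basePiece (P : ℝ) (t : OrientedTile) : Set (ℝ × ℝ × ℝ) :=
  {v | (v.1 ∈ Set.Icc (-1) (-1 + P) ∧
          v.2 ∈ checkerboard ![v.1, 1 - P, 2 - P + v.1] M₁ t) ∨
       (v.1 ∈ Set.Icc (-1 + P) (1 - P) ∧
          v.2 ∈ checkerboard ![-1 + P, v.1, 1 - P] M₂ t) ∨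
       (v.1 ∈ Set.Icc (1 - P) 1 ∧
          v.2 ∈ checkerboard ![-2 + P + v.1, -1 + P, v.1] M₃ t)}

/-- The lattice generated by `(4, 2P, 2P)`, `(0, 2, 0)`, `(0, 0, 2)`. -/
def orientedLattice (P : ℝ) : AddSubgroup (ℝ × ℝ × ℝ) :=
  AddSubgroup.closure {(4, 2 * P, 2 * P), (0, 2, 0), (0, 0, 2)}

/-- The oriented classifying space at the parameter `P`, a three-dimensional torus (with its
quotient topology). -/
abbrev OrientedSpace (P : ℝ) : Type := (ℝ × ℝ × ℝ) ⧸ orientedLattice P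

/-- The (closed) piece of the oriented classifying space that is labelled by the oriented tile `t`.
The set `[-1, 1]³` and its translate by `(2, P, P)` together form a fundamental domain. On
the first the labels are those of `basePiece`; the second is labelled by the translated
partition with all orientations reversed. -/
def piece (P : ℝ) (t : OrientedTile) : Set (OrientedSpace P) :=
  (fun v : ℝ × ℝ × ℝ => (v : OrientedSpace P)) ''
    (basePiece P t ∪ {v | v - (2, P, P) ∈ basePiece P t.reverse})

/-! ### The classifying map and its tilings -/

/-- The oriented classifying map
`(x, y) ↦ (2Px + 2y, 2Px, 2Px + 2Py) + V` modulo the lattice, with offset `V`. -/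
def classifyingMap (P : ℝ) (V : ℝ × ℝ × ℝ) (x y : ℝ) : OrientedSpace P :=
  (((2 * P * x + 2 * y, 2 * P * x, 2 * P * x + 2 * P * y) + V : ℝ × ℝ × ℝ) : OrientedSpace P)

/-- The tile `t` is assigned to the square `[m, m + 1] × [n, n + 1]`: the centre of the square is
mapped to an interior point of the piece labelled by `t`. -/
def AssignsTile (P : ℝ) (V : ℝ × ℝ × ℝ) (m n : ℤ) (t : OrientedTile) : Prop :=
  classifyingMap P V ((m : ℝ) + 1 / 2) ((n : ℝ) + 1 / 2) ∈ interior (piece P t)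

/-- The offset `V` is good: all centres of squares are mapped into the union of the interiors of
the pieces. -/
def GoodOffset (P : ℝ) (V : ℝ × ℝ × ℝ) : Prop :=
  ∀ m n : ℤ, ∃ t, AssignsTile P V m n t

/-- The map with offset `V` produces the tiling `τ`. -/
def Produces (P : ℝ) (V : ℝ × ℝ × ℝ) (τ : ℤ → ℤ → OrientedTile) : Prop :=
  ∀ m n : ℤ, AssignsTile P V m n (τ m n)

end Plaid

end

noncomputable section

namespace Plaid

/-! Each side `e` gets a band in the (T, U)-plane. At a generic point of the cube with T ≠ 1,
exactly one band contains (T, U₁) and exactly one contains (T, U₂). The checkerboard label then says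
that the connector enters `e` iff (T, U₁) is in the band of `e` and (T, U₂) is outside the band of
`e.flip`; it leaves `e` iff both conditions fail (`describes_of_mem_basePiece`). All bands are
2-periodic in U and are complemented by the translation (2, P). So (2, P, P) exchanges entering and
leaving, which is the reversal of labels on the second cube, and the description descends to the
torus (`describes_of_proj_mem_piece`). Coherence is now a symmetry of the bands. A step north adds
(2, 0, 2P) and a step east adds (2P, 2P, 2P); these carry the bands that govern an edge from one
square to the complements of those that govern it from the other (`band_west_shift`,
`band_south_shift`, `band_north_shift`), turning "enters" into "leaves". The finitely many pieces
are closed and cover the torus. A generic point has a single description, so it lies in one piece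
only, hence in its interior (`Generic.proj_mem_interior`). Generic points avoid countably many
planes, so they have full measure and are dense. For an arbitrary good offset the interior
conditions are open, and one moves to a nearby generic point (`exists_generic_describes`). For V = 0
and P = 2p/(p+q), hitting a wall would make an integer multiple of P an odd integer, which parity
forbids. -/

/-- Exchange north and south. -/
def Side.flip : Side → Side
  | .N => .S
  | .S => .N
  | .E => .E
  | .W => .W

/-! ### Bands in the (T, U)-plane and their symmetries -/

/-- The band of the east side in the `(T, U)`-plane. On the strip
`2 k - 1 - P ≤ T < 2 k + 1 - P` its boundary consists of the lines `U = T + k P` and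
`U = 1 - P + k P`, modulo `2`. -/
def eastBand (P T U : ℝ) : Prop :=
  Odd (⌊(U - T - ⌊(T + 1 + P) / 2⌋ * P) / 2⌋ + ⌊(U - 1 + P - ⌊(T + 1 + P) / 2⌋ * P) / 2⌋)

/-- The band of the south side in the square `[-1, 1]²`. -/
def southRegion (P T U : ℝ) : Prop :=
  1 - P < U ∧ T < U ∧ U < 2 - P + T

/-- The band of the south side in the `(T, U)`-plane: `southRegion` after reduction to the square,
complemented on every other strip. -/
def southBand (P T U : ℝ) : Prop :=
  ¬ (southRegion P (T - 2 * ⌊(T + 1) / 2⌋)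
      (U - ⌊(T + 1) / 2⌋ * P - 2 * ⌊(U - ⌊(T + 1) / 2⌋ * P + 1) / 2⌋) ↔ Odd ⌊(T + 1) / 2⌋)

/-- The bands of the four sides. They are invariant under `(0, 2)`, and `(2, P)` maps them to their
complements. -/
def band (P : ℝ) : Side → ℝ → ℝ → Prop
  | .E, T, U => eastBand P T U
  | .W, T, U => ¬ eastBand P (T - 2 * P) (U - 2 * P)
  | .S, T, U => southBand P T U
  | .N, T, U => southBand P T (U - P)

lemma floor_half_add_two (x : ℝ) : ⌊(x + 2) / 2⌋ = ⌊x / 2⌋ + 1 := by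
  rw [← Int.floor_add_one]; congr 1; ring

lemma eastBand_add_two (P T U : ℝ) : eastBand P T (U + 2) ↔ eastBand P T U := by
  unfold eastBand
  set k := ⌊(T + 1 + P) / 2⌋
  rw [show U + 2 - T - k * P = U - T - k * P + 2 by ring,
    show U + 2 - 1 + P - k * P = U - 1 + P - k * P + 2 by ring,
    floor_half_add_two, floor_half_add_two]
  simp only [Int.odd_iff]; omega

/-- The strip index rises by one, so the argument of the first floor drops by one and that of the
second is unchanged: the parity flips. -/
lemma eastBand_translate (P T U : ℝ) : eastBand P (T + 2) (U + P) ↔ ¬ eastBand P T U := by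
  unfold eastBand
  rw [show T + 2 + 1 + P = T + 1 + P + 2 by ring, floor_half_add_two]
  set k := ⌊(T + 1 + P) / 2⌋
  have h : ⌊(U - T - k * P) / 2⌋ = ⌊(U + P - (T + 2) - ((k + 1 : ℤ) : ℝ) * P) / 2⌋ + 1 := by
    rw [← floor_half_add_two]; congr 2; push_cast; ring
  rw [h, show U + P - 1 + P - ((k + 1 : ℤ) : ℝ) * P = U - 1 + P - k * P by push_cast; ring]
  simp only [Int.odd_iff]; omega

lemma southBand_add_two (P T U : ℝ) : southBand P T (U + 2) ↔ southBand P T U := by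
  unfold southBand
  set k := ⌊(T + 1) / 2⌋
  rw [show U + 2 - k * P + 1 = U - k * P + 1 + 2 by ring, floor_half_add_two,
    show U + 2 - k * P - 2 * ((⌊(U - k * P + 1) / 2⌋ + 1 : ℤ) : ℝ)
      = U - k * P - 2 * ⌊(U - k * P + 1) / 2⌋ by push_cast; ring]

/-- The reduced point is unchanged; only the parity of the strip index flips. -/
lemma southBand_translate (P T U : ℝ) : southBand P (T + 2) (U + P) ↔ ¬ southBand P T U := by
  unfold southBand
  rw [show T + 2 + 1 = T + 1 + 2 by ring, floor_half_add_two]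
  set k := ⌊(T + 1) / 2⌋
  rw [show U + P - ((k + 1 : ℤ) : ℝ) * P = U - k * P by push_cast; ring,
    show T + 2 - 2 * ((k + 1 : ℤ) : ℝ) = T - 2 * k by push_cast; ring]
  have : Odd (k + 1) ↔ ¬ Odd k := by simp only [Int.odd_iff]; omega
  rw [this]; tauto

lemma band_add_two (P : ℝ) (e : Side) (T U : ℝ) : band P e T (U + 2) ↔ band P e T U := by
  cases e
  · simpa only [band, sub_add_eq_add_sub] using southBand_add_two P T (U - P)
  · exact southBand_add_two P T U
  · exact eastBand_add_two P T U
  · simpa only [band, sub_add_eq_add_sub] using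
      not_congr (eastBand_add_two P (T - 2 * P) (U - 2 * P))

lemma band_translate (P : ℝ) (e : Side) (T U : ℝ) :
    band P e (T + 2) (U + P) ↔ ¬ band P e T U := by
  cases e
  · simpa only [band, sub_add_eq_add_sub] using southBand_translate P T (U - P)
  · exact southBand_translate P T U
  · exact eastBand_translate P T U
  · simpa only [band, sub_add_eq_add_sub] using
      not_congr (eastBand_translate P (T - 2 * P) (U - 2 * P))

/-- A step east moves both (T, U₁) and (T, U₂) by (2P, 2P). The next two lemmas treat a step north,
which moves (T, U₁) by (2, 0) and (T, U₂) by (2, 2P). -/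
lemma band_west_shift (P T U : ℝ) :
    band P .W (T + 2 * P) (U + 2 * P) ↔ ¬ band P .E T U := by
  simp only [band, add_sub_cancel_right]

lemma band_south_shift (P T U : ℝ) : band P .S (T + 2) U ↔ ¬ band P .N T U := by
  simpa [band] using southBand_translate P T (U - P)

lemma band_north_shift (P T U : ℝ) : band P .N (T + 2) (U + 2 * P) ↔ ¬ band P .S T U := by
  have := southBand_translate P T U
  simpa only [band, show U + 2 * P - P = U + P by ring] using this

/-! ### The bands in the square `[-1, 1]²` -/

lemma floor_half {x : ℝ} {n : ℤ} (h₁ : 2 * n ≤ x) (h₂ : x < 2 * n + 2) : ⌊x / 2⌋ = n := by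
  rw [Int.floor_eq_iff]; constructor <;> linarith

lemma eastBand_iff_odd {P T U : ℝ} (k a b : ℤ) (hk : 2 * (k : ℝ) ≤ T + 1 + P)
    (hk' : T + 1 + P < 2 * k + 2) (ha : 2 * (a : ℝ) ≤ U - T - k * P)
    (ha' : U - T - k * P < 2 * a + 2) (hb : 2 * (b : ℝ) ≤ U - 1 + P - k * P)
    (hb' : U - 1 + P - k * P < 2 * b + 2) : eastBand P T U ↔ Odd (a + b) := by
  unfold eastBand
  rw [floor_half hk hk', floor_half ha ha', floor_half hb hb']

/-- The points `(T, U)` off all the translates of the lines `U = 1` and `U = T` by the group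
`P ℤ + 2 ℤ`. -/
def GenericPair (P T U : ℝ) : Prop :=
  ∀ a b : ℤ, U ≠ 1 + a * P + 2 * b ∧ U ≠ T + a * P + 2 * b

lemma GenericPair.ne_walls {P T U : ℝ} (h : GenericPair P T U) :
    U ≠ 1 ∧ U ≠ -1 ∧ U ≠ T ∧ U ≠ 1 - P ∧ U ≠ -1 + P ∧ U ≠ 2 - P + T ∧ U ≠ -2 + P + T := by
  refine ⟨fun e => (h 0 0).1 ?_, fun e => (h 0 (-1)).1 ?_, fun e => (h 0 0).2 ?_,
    fun e => (h (-1) 0).1 ?_, fun e => (h 1 (-1)).1 ?_, fun e => (h (-1) 1).2 ?_,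
    fun e => (h 1 (-1)).2 ?_⟩ <;> (push_cast; linarith)

/-- The strips of the east band meet at T = 1 - P, exactly where the E-interval has shrunk to a
point, so no exceptional value of T arises. -/
lemma band_east_iff {P T U : ℝ} (hP₀ : 0 < P) (hP₁ : P < 1) (hT₀ : -1 ≤ T) (hT₁ : T ≤ 1)
    (hU₀ : -1 < U) (hU₁ : U < 1) (h : GenericPair P T U) :
    band P .E T U ↔ T < U ∧ U < 1 - P ∨ U < -2 + P + T := by
  obtain ⟨-, -, h1, h2, -, -, h3⟩ := h.ne_walls
  simp only [band]
  rcases lt_or_ge T (1 - P) with hT | hT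
  · rcases lt_or_gt_of_ne h1 with h1 | h1 <;> rcases lt_or_gt_of_ne h2 with h2 | h2
    -- The three integers are the values of the strip index and of the two floors; the parity of the
    -- last two decides.
    · rw [eastBand_iff_odd 0 (-1) (-1)] <;> first | (push_cast; linarith) | skip
      exact iff_of_false (by decide) (by rintro (⟨_, _⟩ | _) <;> linarith)
    · linarith
    · rw [eastBand_iff_odd 0 0 (-1)] <;> first | (push_cast; linarith) | skip
      exact iff_of_true (by decide) (.inl ⟨h1, h2⟩)
    · rw [eastBand_iff_odd 0 0 0] <;> first | (push_cast; linarith) | skip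
      exact iff_of_false (by decide) (by rintro (⟨_, _⟩ | _) <;> linarith)
  · rcases lt_or_gt_of_ne h3 with h3 | h3
    · rw [eastBand_iff_odd 1 (-2) (-1)] <;> first | (push_cast; linarith) | skip
      exact iff_of_true (by decide) (.inr h3)
    · rw [eastBand_iff_odd 1 (-1) (-1)] <;> first | (push_cast; linarith) | skip
      exact iff_of_false (by decide) (by rintro (⟨_, _⟩ | _) <;> linarith)

lemma band_west_iff {P T U : ℝ} (hP₀ : 0 < P) (hP₁ : P < 1) (hT₀ : -1 ≤ T) (hT₁ : T ≤ 1)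
    (hU₀ : -1 < U) (hU₁ : U < 1) (h : GenericPair P T U) :
    band P .W T U ↔ -1 + P < U ∧ U < T ∨ 2 - P + T < U := by
  obtain ⟨-, -, h1, -, h2, h3, -⟩ := h.ne_walls
  simp only [band]
  -- The seam -1 - P of the east strips, moved by 2P.
  rcases lt_or_ge T (-1 + P) with hT | hT
  · rcases lt_or_gt_of_ne h3 with h3 | h3
    · rw [eastBand_iff_odd (-1) 0 (-1)] <;> first | (push_cast; linarith) | skip
      exact iff_of_false (by decide) (by rintro (⟨_, _⟩ | _) <;> linarith)
    · rw [eastBand_iff_odd (-1) 1 (-1)] <;> first | (push_cast; linarith) | skip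
      exact iff_of_true (by decide) (.inr h3)
  · rcases lt_or_gt_of_ne h1 with h1 | h1 <;> rcases lt_or_gt_of_ne h2 with h2 | h2
    · rw [eastBand_iff_odd 0 (-1) (-2)] <;> first | (push_cast; linarith) | skip
      exact iff_of_false (by decide) (by rintro (⟨_, _⟩ | _) <;> linarith)
    · rw [eastBand_iff_odd 0 (-1) (-1)] <;> first | (push_cast; linarith) | skip
      exact iff_of_true (by decide) (.inl ⟨h2, h1⟩)
    · linarith
    · rw [eastBand_iff_odd 0 0 (-1)] <;> first | (push_cast; linarith) | skip
      exact iff_of_false (by decide) (by rintro (⟨_, _⟩ | _) <;> linarith)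

/-- The integer `n` is free because the north band evaluates this at U - P, which may fall below -1.
-/
lemma southBand_iff {P T U : ℝ} (n : ℤ) (hT₀ : -1 ≤ T) (hT : T < 1) (hn : 2 * (n : ℝ) ≤ U + 1)
    (hn' : U + 1 < 2 * n + 2) :
    southBand P T U ↔ 1 - P < U - 2 * n ∧ T < U - 2 * n ∧ U - 2 * n < 2 - P + T := by
  unfold southBand
  rw [floor_half (n := 0) (x := T + 1) (by push_cast; linarith) (by push_cast; linarith)]
  rw [floor_half (n := n) (by push_cast; linarith) (by push_cast; linarith)]
  simp [southRegion]

lemma band_south_iff {P T U : ℝ} (hT₀ : -1 ≤ T) (hT : T < 1) (hU₀ : -1 < U) (hU₁ : U < 1) :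
    band P .S T U ↔ 1 - P < U ∧ T < U ∧ U < 2 - P + T := by
  simpa [band] using southBand_iff (P := P) (U := U) 0 hT₀ hT (by push_cast; linarith)
    (by push_cast; linarith)

lemma band_north_iff {P T U : ℝ} (hP₀ : 0 < P) (hP₁ : P < 1) (hT₀ : -1 ≤ T) (hT : T < 1)
    (hU₀ : -1 < U) (hU₁ : U < 1) (h : GenericPair P T U) :
    band P .N T U ↔ U < -1 + P ∧ -2 + P + T < U ∧ U < T := by
  obtain ⟨-, -, -, -, h2, -⟩ := h.ne_walls
  simp only [band]
  rcases lt_or_gt_of_ne h2 with h2 | h2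
  · rw [southBand_iff (-1) hT₀ hT] <;> first | (push_cast; linarith) | skip
    push_cast
    constructor <;> rintro ⟨_, _, _⟩ <;> refine ⟨?_, ?_, ?_⟩ <;> linarith
  · rw [southBand_iff 0 hT₀ hT] <;> first | (push_cast; linarith) | skip
    push_cast
    constructor <;> rintro ⟨_, _, _⟩ <;> linarith

/-- T = 1 belongs to the next, complemented strip, where it reduces to T = -1 and the region is
empty. This value cannot be discarded as non-generic: for V = 0, the column with 2m + 1 = p + q has
odd T. -/
lemma southBand_one {P U : ℝ} : southBand P 1 U := by
  unfold southBand southRegion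
  rw [floor_half (n := 1) (x := (1 : ℝ) + 1) (by norm_num) (by norm_num)]
  intro h
  obtain ⟨_, _, _⟩ := h.2 odd_one
  push_cast at *
  linarith

/-- The bands through `(T, U)` when the symbol of the interval containing `U` is `c`: at `T = 1`,
where the intervals of `N` and `S` are degenerate, the bands of `N` and `S` are everything. -/
def HasSymbol (P T U : ℝ) (c : Side) : Prop :=
  (∀ e, band P e T U ↔ c = e ∨ T = 1 ∧ (e = .N ∨ e = .S)) ∧ (T = 1 → c ≠ .N ∧ c ≠ .S)

/-- The part of the square `[-1, 1]²` of points `(T, U)` that carries the symbol `e`. -/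
def region (P T U : ℝ) : Side → Prop
  | .N => U < -1 + P ∧ -2 + P + T < U ∧ U < T
  | .S => 1 - P < U ∧ T < U ∧ U < 2 - P + T
  | .E => T < U ∧ U < 1 - P ∨ U < -2 + P + T
  | .W => -1 + P < U ∧ U < T ∨ 2 - P + T < U

lemma region_unique {P T U : ℝ} (hP₁ : P < 1) (hT₀ : -1 ≤ T) (hT₁ : T ≤ 1) {c e : Side}
    (hc : region P T U c) (he : region P T U e) : c = e := by
  cases c <;> cases e <;> first
    | rfl
    | (exfalso
       simp only [region] at hc he
       obtain ⟨_, _, _⟩ := hc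
       obtain ⟨_, _, _⟩ := he
       linarith)
    | (exfalso
       simp only [region] at hc he
       obtain ⟨_, _, _⟩ := hc
       obtain ⟨_, _⟩ | _ := he <;> linarith)
    | (exfalso
       simp only [region] at hc he
       obtain ⟨_, _, _⟩ := he
       obtain ⟨_, _⟩ | _ := hc <;> linarith)
    | (exfalso
       simp only [region] at hc he
       obtain ⟨_, _⟩ | _ := he <;> obtain ⟨_, _⟩ | _ := hc <;> linarith)

lemma hasSymbol_of_region {P T U : ℝ} (hP₀ : 0 < P) (hP₁ : P < 1) (hT₀ : -1 ≤ T) (hT₁ : T ≤ 1)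
    (hU₀ : -1 < U) (hU₁ : U < 1) (h : GenericPair P T U) {c : Side} (hc : region P T U c) :
    HasSymbol P T U c := by
  have key (e : Side) : region P T U e ↔ c = e :=
    ⟨region_unique hP₁ hT₀ hT₁ hc, fun he => he ▸ hc⟩
  have hE := (band_east_iff hP₀ hP₁ hT₀ hT₁ hU₀ hU₁ h).trans (key .E)
  have hW := (band_west_iff hP₀ hP₁ hT₀ hT₁ hU₀ hU₁ h).trans (key .W)
  rcases hT₁.lt_or_eq with hT | rfl
  · refine ⟨fun e => ?_, fun h => absurd h hT.ne⟩
    have hN := (band_north_iff hP₀ hP₁ hT₀ hT hU₀ hU₁ h).trans (key .N)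
    have hS := (band_south_iff hT₀ hT hU₀ hU₁).trans (key .S)
    cases e <;> simp [hT.ne, *]
  · refine ⟨fun e => ?_, fun _ => ⟨fun hN => ?_, fun hS => ?_⟩⟩
    · cases e
      · simp [band, southBand_one]
      · simp [band, southBand_one]
      · simp [hE]
      · simp [hW]
    · obtain ⟨_, _, _⟩ := (key .N).2 hN; linarith
    · obtain ⟨_, _, _⟩ := (key .S).2 hS; linarith

/-! ### Symbols of the checkerboard intervals -/

/-- The symbols of the columns of `M₁`, from left to right; also the symbols of its rows from bottom
to top, up to the exchange of north and south. -/
def symbol₁ : Fin 4 → Side := ![.N, .E, .S, .W]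

/-- The symbols of the columns of `M₂`. -/
def symbol₂ : Fin 4 → Side := ![.N, .W, .E, .S]

/-- The symbols of the columns of `M₃`. -/
def symbol₃ : Fin 4 → Side := ![.E, .N, .W, .S]

lemma mem_cut_cases {u : Fin 3 → ℝ} {U : ℝ} {j : Fin 4}
    (hU : U ∈ Set.Icc (cut u j.castSucc) (cut u j.succ)) :
    j = 0 ∧ -1 ≤ U ∧ U ≤ u 0 ∨ j = 1 ∧ u 0 ≤ U ∧ U ≤ u 1 ∨ j = 2 ∧ u 1 ≤ U ∧ U ≤ u 2 ∨
      j = 3 ∧ u 2 ≤ U ∧ U ≤ 1 := by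
  fin_cases j
  · exact .inl ⟨rfl, hU⟩
  · exact .inr (.inl ⟨rfl, hU⟩)
  · exact .inr (.inr (.inl ⟨rfl, hU⟩))
  · exact .inr (.inr (.inr ⟨rfl, hU⟩))

/-- Genericity makes the inequalities of the closed interval strict, which puts (T, U) in the region
of its symbol. -/
lemma hasSymbol₁ {P T U : ℝ} (hP₀ : 0 < P) (hP₁ : P < 1) (hT₀ : -1 ≤ T) (hT₁ : T ≤ -1 + P)
    (h : GenericPair P T U) (j : Fin 4)
    (hU : U ∈ Set.Icc (cut ![T, 1 - P, 2 - P + T] j.castSucc)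
      (cut ![T, 1 - P, 2 - P + T] j.succ)) : HasSymbol P T U (symbol₁ j) := by
  obtain ⟨h1, h2, h3, h4, h5, h6, h7⟩ := h.ne_walls
  obtain ⟨rfl, hl, hr⟩ | ⟨rfl, hl, hr⟩ | ⟨rfl, hl, hr⟩ | ⟨rfl, hl, hr⟩ := mem_cut_cases hU
  · replace hl : -1 < U := lt_of_le_of_ne hl h2.symm
    replace hr : U < T := lt_of_le_of_ne hr h3
    refine hasSymbol_of_region hP₀ hP₁ hT₀ ?_ ?_ ?_ h ⟨?_, ?_, ?_⟩ <;> linarith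
  · replace hl : T < U := lt_of_le_of_ne hl h3.symm
    replace hr : U < 1 - P := lt_of_le_of_ne hr h4
    refine hasSymbol_of_region hP₀ hP₁ hT₀ ?_ ?_ ?_ h (.inl ⟨?_, ?_⟩) <;> linarith
  · replace hl : 1 - P < U := lt_of_le_of_ne hl h4.symm
    replace hr : U < 2 - P + T := lt_of_le_of_ne hr h6
    refine hasSymbol_of_region hP₀ hP₁ hT₀ ?_ ?_ ?_ h ⟨?_, ?_, ?_⟩ <;> linarith
  · replace hl : 2 - P + T < U := lt_of_le_of_ne hl h6.symm
    replace hr : U < 1 := lt_of_le_of_ne hr h1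
    refine hasSymbol_of_region hP₀ hP₁ hT₀ ?_ ?_ ?_ h (.inr ?_) <;> linarith

lemma hasSymbol₂ {P T U : ℝ} (hP₀ : 0 < P) (hP₁ : P < 1) (hT₀ : -1 + P ≤ T) (hT₁ : T ≤ 1 - P)
    (h : GenericPair P T U) (j : Fin 4)
    (hU : U ∈ Set.Icc (cut ![-1 + P, T, 1 - P] j.castSucc)
      (cut ![-1 + P, T, 1 - P] j.succ)) : HasSymbol P T U (symbol₂ j) := by
  obtain ⟨h1, h2, h3, h4, h5, h6, h7⟩ := h.ne_walls
  obtain ⟨rfl, hl, hr⟩ | ⟨rfl, hl, hr⟩ | ⟨rfl, hl, hr⟩ | ⟨rfl, hl, hr⟩ := mem_cut_cases hU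
  · replace hl : -1 < U := lt_of_le_of_ne hl h2.symm
    replace hr : U < -1 + P := lt_of_le_of_ne hr h5
    refine hasSymbol_of_region hP₀ hP₁ ?_ ?_ ?_ ?_ h ⟨?_, ?_, ?_⟩ <;> linarith
  · replace hl : -1 + P < U := lt_of_le_of_ne hl h5.symm
    replace hr : U < T := lt_of_le_of_ne hr h3
    refine hasSymbol_of_region hP₀ hP₁ ?_ ?_ ?_ ?_ h (.inl ⟨?_, ?_⟩) <;> linarith
  · replace hl : T < U := lt_of_le_of_ne hl h3.symm
    replace hr : U < 1 - P := lt_of_le_of_ne hr h4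
    refine hasSymbol_of_region hP₀ hP₁ ?_ ?_ ?_ ?_ h (.inl ⟨?_, ?_⟩) <;> linarith
  · replace hl : 1 - P < U := lt_of_le_of_ne hl h4.symm
    replace hr : U < 1 := lt_of_le_of_ne hr h1
    refine hasSymbol_of_region hP₀ hP₁ ?_ ?_ ?_ ?_ h ⟨?_, ?_, ?_⟩ <;> linarith

lemma hasSymbol₃ {P T U : ℝ} (hP₀ : 0 < P) (hP₁ : P < 1) (hT₀ : 1 - P ≤ T) (hT₁ : T ≤ 1)
    (h : GenericPair P T U) (j : Fin 4)
    (hU : U ∈ Set.Icc (cut ![-2 + P + T, -1 + P, T] j.castSucc)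
      (cut ![-2 + P + T, -1 + P, T] j.succ)) : HasSymbol P T U (symbol₃ j) := by
  obtain ⟨h1, h2, h3, h4, h5, h6, h7⟩ := h.ne_walls
  obtain ⟨rfl, hl, hr⟩ | ⟨rfl, hl, hr⟩ | ⟨rfl, hl, hr⟩ | ⟨rfl, hl, hr⟩ := mem_cut_cases hU
  · replace hl : -1 < U := lt_of_le_of_ne hl h2.symm
    replace hr : U < -2 + P + T := lt_of_le_of_ne hr h7
    refine hasSymbol_of_region hP₀ hP₁ ?_ hT₁ ?_ ?_ h (.inr ?_) <;> linarith
  · replace hl : -2 + P + T < U := lt_of_le_of_ne hl h7.symm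
    replace hr : U < -1 + P := lt_of_le_of_ne hr h5
    refine hasSymbol_of_region hP₀ hP₁ ?_ hT₁ ?_ ?_ h ⟨?_, ?_, ?_⟩ <;> linarith
  · replace hl : -1 + P < U := lt_of_le_of_ne hl h5.symm
    replace hr : U < T := lt_of_le_of_ne hr h3
    refine hasSymbol_of_region hP₀ hP₁ ?_ hT₁ ?_ ?_ h (.inl ⟨?_, ?_⟩) <;> linarith
  · replace hl : T < U := lt_of_le_of_ne hl h3.symm
    replace hr : U < 1 := lt_of_le_of_ne hr h1
    refine hasSymbol_of_region hP₀ hP₁ ?_ hT₁ ?_ ?_ h ⟨?_, ?_, ?_⟩ <;> linarith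

/-! ### Labels in terms of bands -/

/-- The tile with connector from `a` to `b`, empty if `a = b`. -/
def connect (a b : Side) : OrientedTile :=
  if h : a = b then .empty else .connector a b h

lemma pointsInto_connect (a b e : Side) : (connect a b).PointsInto e ↔ a ≠ b ∧ b = e := by
  unfold connect; split_ifs <;> simp [OrientedTile.PointsInto, *]

lemma pointsOutOf_connect (a b e : Side) : (connect a b).PointsOutOf e ↔ a ≠ b ∧ a = e := by
  unfold connect; split_ifs <;> simp [OrientedTile.PointsOutOf, *]

lemma pointsInto_reverse (t : OrientedTile) (e : Side) :
    t.reverse.PointsInto e ↔ t.PointsOutOf e := by cases t <;> rfl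

lemma pointsOutOf_reverse (t : OrientedTile) (e : Side) :
    t.reverse.PointsOutOf e ↔ t.PointsInto e := by cases t <;> rfl

lemma OrientedTile.reverse_reverse (t : OrientedTile) : t.reverse.reverse = t := by
  cases t <;> rfl

lemma OrientedTile.ext_points {t t' : OrientedTile} (h : ∀ e, t.PointsInto e ↔ t'.PointsInto e)
    (h' : ∀ e, t.PointsOutOf e ↔ t'.PointsOutOf e) : t = t' := by
  cases t with
  | empty =>
    cases t' with
    | empty => rfl
    | connector a b _ => exact ((h b).2 rfl).elim
  | connector a b _ =>
    cases t' with
    | empty => exact ((h b).1 rfl).elim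
    | connector a' b' _ =>
      obtain rfl : b' = b := (h b).1 rfl
      obtain rfl : a' = a := (h' a).1 rfl
      rfl

/-- The symbols of the rows and columns of `M` are given by `s`: from left to right for the
columns, from bottom to top and with north and south exchanged for the rows. -/
def SymbolsGivenBy (M : Fin 4 → Fin 4 → Option Side) (s : Fin 4 → Side) : Prop :=
  ∀ i j, (M i j ≠ none ↔ (s i.rev).flip = s j) ∧ (∀ a, (∃ k, M i k = some a) ↔ (s i.rev).flip = a) ∧
    ∀ b, (∃ k, M k j = some b) ↔ s j = b

instance : Fintype Side where
  elems := {.N, .S, .E, .W}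
  complete := by intro x; cases x <;> decide

lemma symbolsGivenBy₁ : SymbolsGivenBy M₁ symbol₁ := by unfold SymbolsGivenBy; decide
lemma symbolsGivenBy₂ : SymbolsGivenBy M₂ symbol₂ := by unfold SymbolsGivenBy; decide
lemma symbolsGivenBy₃ : SymbolsGivenBy M₃ symbol₃ := by unfold SymbolsGivenBy; decide

lemma SymbolsGivenBy.hasLabel_iff {M : Fin 4 → Fin 4 → Option Side} {s : Fin 4 → Side}
    (h : SymbolsGivenBy M s) (i j : Fin 4) (t : OrientedTile) :
    HasLabel M i j t ↔ t = connect (s i.rev).flip (s j) := by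
  obtain ⟨h1, h2, h3⟩ := h i j
  unfold connect
  cases t with
  | empty =>
    simp only [HasLabel, h1]
    split_ifs with h <;> simp [h]
  | connector a b hab =>
    have h1' : M i j = none ↔ (s i.rev).flip ≠ s j := by rw [Ne, ← h1]; simp
    simp only [HasLabel, h1', h2, h3]
    split_ifs with h
    · simp [h]
    · simp [h, eq_comm]

/-- The connector at the point `(T, U₁, U₂)` of the universal cover points into the side `e`. -/
def Into (P : ℝ) (e : Side) (v : ℝ × ℝ × ℝ) : Prop :=
  band P e v.1 v.2.1 ∧ ¬ band P e.flip v.1 v.2.2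

/-- The connector at the point `(T, U₁, U₂)` of the universal cover points out of the side `e`. -/
def OutOf (P : ℝ) (e : Side) (v : ℝ × ℝ × ℝ) : Prop :=
  band P e.flip v.1 v.2.2 ∧ ¬ band P e v.1 v.2.1

/-- The tile `t` has the connector described by `Into` and `OutOf` at `v`. -/
def Describes (P : ℝ) (v : ℝ × ℝ × ℝ) (t : OrientedTile) : Prop :=
  ∀ e, (t.PointsInto e ↔ Into P e v) ∧ (t.PointsOutOf e ↔ OutOf P e v)

/-- Both pairs `(T, U₁)` and `(T, U₂)` are generic. -/
def Generic (P : ℝ) (v : ℝ × ℝ × ℝ) : Prop :=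
  GenericPair P v.1 v.2.1 ∧ GenericPair P v.1 v.2.2

/-- A finite check. At T = 1 the extra N and S bands hold for both coordinates, so they cancel in
`Into` and `OutOf`. -/
lemma describes_connect {P : ℝ} {v : ℝ × ℝ × ℝ} {c d : Side} (hc : HasSymbol P v.1 v.2.1 c)
    (hd : HasSymbol P v.1 v.2.2 d) : Describes P v (connect d.flip c) := by
  obtain ⟨hc, hc'⟩ := hc
  obtain ⟨hd, hd'⟩ := hd
  intro e
  rw [pointsInto_connect, pointsOutOf_connect, Into, OutOf, hc, hd]
  by_cases hT : v.1 = 1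
  · obtain ⟨_, _⟩ := hc' hT
    obtain ⟨_, _⟩ := hd' hT
    cases c <;> cases d <;> cases e <;> simp_all [Side.flip]
  · simp only [hT, false_and, or_false]
    cases c <;> cases d <;> cases e <;> simp [Side.flip]

lemma describes_of_mem_checkerboard {P T : ℝ} {z : ℝ × ℝ} {t : OrientedTile} {u : Fin 3 → ℝ}
    {M : Fin 4 → Fin 4 → Option Side} {s : Fin 4 → Side} (hM : SymbolsGivenBy M s)
    (hs : ∀ U, GenericPair P T U → ∀ j : Fin 4,
      U ∈ Set.Icc (cut u j.castSucc) (cut u j.succ) → HasSymbol P T U (s j))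
    (hz : Generic P (T, z)) (h : z ∈ checkerboard u M t) : Describes P (T, z) t := by
  obtain ⟨i, j, hl, hj, hi⟩ := h
  rw [hM.hasLabel_iff] at hl
  subst hl
  exact describes_connect (hs _ hz.1 _ hj) (hs _ hz.2 _ hi)

lemma describes_of_mem_basePiece {P : ℝ} (hP₀ : 0 < P) (hP₁ : P < 1) {v : ℝ × ℝ × ℝ}
    {t : OrientedTile} (hv : Generic P v) (h : v ∈ basePiece P t) : Describes P v t := by
  obtain ⟨hT, h⟩ | ⟨hT, h⟩ | ⟨hT, h⟩ := h
  · exact describes_of_mem_checkerboard symbolsGivenBy₁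
      (fun U hU => hasSymbol₁ hP₀ hP₁ hT.1 hT.2 hU) hv h
  · exact describes_of_mem_checkerboard symbolsGivenBy₂
      (fun U hU => hasSymbol₂ hP₀ hP₁ hT.1 hT.2 hU) hv h
  · exact describes_of_mem_checkerboard symbolsGivenBy₃
      (fun U hU => hasSymbol₃ hP₀ hP₁ hT.1 hT.2 hU) hv h

/-! ### Translations -/

/-- Invariance under all of Pℤ + 2ℤ in each coordinate covers the lattice, (2, P, P) and the steps
between neighbouring centres. -/
lemma GenericPair.translate {P T U T' U' : ℝ} (h : GenericPair P T U) (a b c d : ℤ)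
    (hU : U' = U + a * P + 2 * b) (hT : T' = T + c * P + 2 * d) : GenericPair P T' U' := by
  intro m n
  constructor
  · intro e
    apply (h (m - a) (n - b)).1
    push_cast; linarith
  · intro e
    apply (h (m - a + c) (n - b + d)).2
    push_cast; linarith

lemma Generic.translate {P : ℝ} {v : ℝ × ℝ × ℝ} (h : Generic P v) (a b a' b' c d : ℤ) :
    Generic P (v + (c * P + 2 * d, a * P + 2 * b, a' * P + 2 * b')) :=
  ⟨h.1.translate a b c d (add_assoc _ _ _).symm (add_assoc _ _ _).symm,
    h.2.translate a' b' c d (add_assoc _ _ _).symm (add_assoc _ _ _).symm⟩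

lemma into_translate (P : ℝ) (e : Side) (v : ℝ × ℝ × ℝ) :
    Into P e (v + (2, P, P)) ↔ OutOf P e v := by
  simp only [Into, OutOf, Prod.fst_add, Prod.snd_add, band_translate]; tauto

lemma outOf_translate (P : ℝ) (e : Side) (v : ℝ × ℝ × ℝ) :
    OutOf P e (v + (2, P, P)) ↔ Into P e v := by
  simp only [Into, OutOf, Prod.fst_add, Prod.snd_add, band_translate]; tauto

lemma describes_translate {P : ℝ} {v : ℝ × ℝ × ℝ} {t : OrientedTile} :
    Describes P (v + (2, P, P)) t ↔ Describes P v t.reverse := by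
  simp only [Describes, into_translate, outOf_translate, pointsInto_reverse, pointsOutOf_reverse]
  exact forall_congr' fun e => and_comm

lemma mem_orientedLattice {P : ℝ} {v : ℝ × ℝ × ℝ} :
    v ∈ orientedLattice P ↔
      ∃ a b c : ℤ, v = (4 * (a : ℝ), 2 * P * a + 2 * b, 2 * P * a + 2 * c) := by
  constructor
  · intro h
    induction h using AddSubgroup.closure_induction with
    | mem x hx =>
      obtain rfl | rfl | rfl := hx
      · exact ⟨1, 0, 0, by simp⟩
      · exact ⟨0, 1, 0, by simp⟩
      · exact ⟨0, 0, 1, by simp⟩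
    | zero => exact ⟨0, 0, 0, by simp; rfl⟩
    | add x y _ _ hx hy =>
      obtain ⟨a, b, c, rfl⟩ := hx
      obtain ⟨a', b', c', rfl⟩ := hy
      refine ⟨a + a', b + b', c + c', ?_⟩
      simp only [Prod.mk_add_mk, Prod.mk.injEq]; push_cast
      exact ⟨by ring, by ring, by ring⟩
    | neg x _ hx =>
      obtain ⟨a, b, c, rfl⟩ := hx
      refine ⟨-a, -b, -c, ?_⟩
      simp only [Prod.neg_mk, Prod.mk.injEq]; push_cast
      exact ⟨by ring, by ring, by ring⟩
  · rintro ⟨a, b, c, rfl⟩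
    have h : ((4 * (a : ℝ), 2 * P * a + 2 * b, 2 * P * a + 2 * c) : ℝ × ℝ × ℝ) =
        a • (4, 2 * P, 2 * P) + b • (0, 2, 0) + c • (0, 0, 2) := by
      simp only [Prod.smul_mk, Prod.mk_add_mk, Prod.mk.injEq, zsmul_eq_mul]
      exact ⟨by ring, by ring, by ring⟩
    rw [h]
    refine add_mem (add_mem (zsmul_mem ?_ _) (zsmul_mem ?_ _)) (zsmul_mem ?_ _) <;>
      exact AddSubgroup.subset_closure (by simp)

/-- The generator (4, 2P, 2P) is twice (2, P, P), so the two reversals cancel. -/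
lemma describes_add_mem_lattice {P : ℝ} {v l : ℝ × ℝ × ℝ} {t : OrientedTile}
    (hl : l ∈ orientedLattice P) : Describes P (v + l) t ↔ Describes P v t := by
  induction hl using AddSubgroup.closure_induction generalizing v with
  | mem x hx =>
    obtain rfl | rfl | rfl := hx
    · have : v + (4, 2 * P, 2 * P) = v + (2, P, P) + (2, P, P) := by
        rw [add_assoc]; congr 1
        simp only [Prod.mk_add_mk, Prod.mk.injEq]
        exact ⟨by norm_num, by ring, by ring⟩
      rw [this, describes_translate, describes_translate, OrientedTile.reverse_reverse]
    · simp only [Describes, Into, OutOf, Prod.fst_add, Prod.snd_add, band_add_two, add_zero]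
    · simp only [Describes, Into, OutOf, Prod.fst_add, Prod.snd_add, band_add_two, add_zero]
  | zero => rw [add_zero]
  | add x y _ _ hx hy => rw [← add_assoc, hy, hx]
  | neg x _ hx => rw [← hx, neg_add_cancel_right]

lemma Generic.add_mem_lattice {P : ℝ} {v l : ℝ × ℝ × ℝ} (hv : Generic P v)
    (hl : l ∈ orientedLattice P) : Generic P (v + l) := by
  obtain ⟨a, b, c, rfl⟩ := mem_orientedLattice.1 hl
  convert hv.translate (2 * a) b (2 * a) c 0 (2 * a) using 2
  simp only [Prod.mk.injEq]; push_cast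
  exact ⟨by ring, by ring, by ring⟩

/-- The projection of the universal cover onto the oriented classifying space. -/
abbrev proj (P : ℝ) (v : ℝ × ℝ × ℝ) : OrientedSpace P := (v : OrientedSpace P)

lemma describes_of_proj_mem_piece {P : ℝ} (hP₀ : 0 < P) (hP₁ : P < 1) {v : ℝ × ℝ × ℝ}
    {t : OrientedTile} (hv : Generic P v) (h : proj P v ∈ piece P t) : Describes P v t := by
  obtain ⟨w, hw, hwv⟩ := h
  have hl : -w + v ∈ orientedLattice P := QuotientAddGroup.eq.1 hwv
  have hw' : Generic P w := by
    simpa using hv.add_mem_lattice (neg_mem hl)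
  suffices Describes P w t by
    simpa using (describes_add_mem_lattice hl).2 this
  obtain hw | hw := hw
  · exact describes_of_mem_basePiece hP₀ hP₁ hw' hw
  · have hg : Generic P (w - (2, P, P)) := by
      convert hw'.translate (-1) 0 (-1) 0 0 (-1) using 2
      rw [sub_eq_add_neg]; congr 1; simp
    simpa using describes_translate.2 (describes_of_mem_basePiece hP₀ hP₁ hg hw)

lemma Describes.unique {P : ℝ} {v : ℝ × ℝ × ℝ} {t t' : OrientedTile} (h : Describes P v t)
    (h' : Describes P v t') : t = t' :=
  OrientedTile.ext_points (fun e => (h e).1.trans (h' e).1.symm)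
    fun e => (h e).2.trans (h' e).2.symm

lemma match_north_of_describes {P : ℝ} {v : ℝ × ℝ × ℝ} {t t' : OrientedTile}
    (h : Describes P v t) (h' : Describes P (v + (2, 0, 2 * P)) t') : Match t .N t' .S := by
  rw [Match, (h _).1, (h _).2, (h' _).1, (h' _).2]
  simp only [Into, OutOf, Side.flip, Prod.fst_add, Prod.snd_add, add_zero, band_south_shift,
    band_north_shift, not_not]
  tauto

lemma match_east_of_describes {P : ℝ} {v : ℝ × ℝ × ℝ} {t t' : OrientedTile}
    (h : Describes P v t) (h' : Describes P (v + (2 * P, 2 * P, 2 * P)) t') :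
    Match t .E t' .W := by
  rw [Match, (h _).1, (h _).2, (h' _).1, (h' _).2]
  simp only [Into, OutOf, Side.flip, Prod.fst_add, Prod.snd_add, band_west_shift, not_not]
  tauto

/-! ### Topology of the pieces -/

lemma isClosed_orientedLattice (P : ℝ) : IsClosed (orientedLattice P : Set (ℝ × ℝ × ℝ)) := by
  have h : (orientedLattice P : Set (ℝ × ℝ × ℝ)) =
      (fun v => v.1 / 4) ⁻¹' Set.range ((↑) : ℤ → ℝ) ∩
        ((fun v => (v.2.1 - P * v.1 / 2) / 2) ⁻¹' Set.range ((↑) : ℤ → ℝ) ∩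
          (fun v => (v.2.2 - P * v.1 / 2) / 2) ⁻¹' Set.range ((↑) : ℤ → ℝ)) := by
    ext v
    rw [SetLike.mem_coe, mem_orientedLattice]
    constructor
    · rintro ⟨a, b, c, rfl⟩
      exact ⟨⟨a, by ring⟩, ⟨b, by ring⟩, ⟨c, by ring⟩⟩
    · rintro ⟨⟨a, ha⟩, ⟨b, hb⟩, ⟨c, hc⟩⟩
      refine ⟨a, b, c, Prod.ext ?_ (Prod.ext ?_ ?_)⟩
      · simp only [ha]; ring
      · simp only [ha, hb]; ring
      · simp only [ha, hc]; ring
  have hZ : IsClosed (Set.range ((↑) : ℤ → ℝ)) := Int.isClosedEmbedding_coe_real.isClosed_range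
  rw [h]
  exact (hZ.preimage (by fun_prop)).inter
    ((hZ.preimage (by fun_prop)).inter (hZ.preimage (by fun_prop)))

instance (P : ℝ) : T2Space (OrientedSpace P) := by
  have : IsClosed (orientedLattice P : Set (ℝ × ℝ × ℝ)) := isClosed_orientedLattice P
  infer_instance

lemma isCompact_checkerboard_part {a b : ℝ} {f g h : ℝ → ℝ} (hf : Continuous f)
    (hg : Continuous g) (hh : Continuous h) (hb : ∀ T ∈ Set.Icc a b,
      f T ∈ Set.Icc (-1) 1 ∧ g T ∈ Set.Icc (-1) 1 ∧ h T ∈ Set.Icc (-1) 1)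
    (M : Fin 4 → Fin 4 → Option Side) (t : OrientedTile) :
    IsCompact {v : ℝ × ℝ × ℝ |
      v.1 ∈ Set.Icc a b ∧ v.2 ∈ checkerboard ![f v.1, g v.1, h v.1] M t} := by
  have hcont (m : Fin 5) : Continuous fun v : ℝ × ℝ × ℝ => cut ![f v.1, g v.1, h v.1] m := by
    fin_cases m
    · exact continuous_const
    · exact hf.comp continuous_fst
    · exact hg.comp continuous_fst
    · exact hh.comp continuous_fst
    · exact continuous_const
  have hbound {T : ℝ} (hT : T ∈ Set.Icc a b) (m : Fin 5) :
      cut ![f T, g T, h T] m ∈ Set.Icc (-1) 1 := by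
    fin_cases m
    · exact ⟨le_refl (-1 : ℝ), by simp [cut]⟩
    · exact (hb T hT).1
    · exact (hb T hT).2.1
    · exact (hb T hT).2.2
    · exact ⟨by simp [cut], le_refl (1 : ℝ)⟩
  refine IsCompact.of_isClosed_subset
    (isCompact_Icc.prod ((isCompact_Icc (a := (-1 : ℝ)) (b := 1)).prod
      (isCompact_Icc (a := (-1 : ℝ)) (b := 1)))) ?_ ?_ (s := Set.Icc a b ×ˢ _)
  · have : {v : ℝ × ℝ × ℝ | v.1 ∈ Set.Icc a b ∧ v.2 ∈ checkerboard ![f v.1, g v.1, h v.1] M t} =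
        ⋃ i : Fin 4, ⋃ j : Fin 4, {v | HasLabel M i j t} ∩ ({v | v.1 ∈ Set.Icc a b} ∩
          {v | v.2 ∈ cell ![f v.1, g v.1, h v.1] i j}) := by
      ext v
      simp only [checkerboard, Set.mem_ofPred_eq, Set.mem_iUnion, Set.mem_inter_iff]
      tauto
    rw [this]
    refine isClosed_iUnion_of_finite fun i => isClosed_iUnion_of_finite fun j =>
      isClosed_const.inter ((isClosed_Icc.preimage continuous_fst).inter ?_)
    exact ((isClosed_le (hcont _) (by fun_prop)).inter (isClosed_le (by fun_prop) (hcont _))).inter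
      ((isClosed_le (hcont _) (by fun_prop)).inter (isClosed_le (by fun_prop) (hcont _)))
  · rintro v ⟨hT, i, j, -, h1, h2⟩
    exact ⟨hT, ⟨(hbound hT _).1.trans h1.1, h1.2.trans (hbound hT _).2⟩,
      ⟨(hbound hT _).1.trans h2.1, h2.2.trans (hbound hT _).2⟩⟩

lemma isCompact_basePiece {P : ℝ} (hP₀ : 0 < P) (hP₁ : P < 1) (t : OrientedTile) :
    IsCompact (basePiece P t) := by
  refine (isCompact_checkerboard_part (f := fun T => T) (g := fun _ => 1 - P)
    (h := fun T => 2 - P + T) (by fun_prop) (by fun_prop) (by fun_prop) ?_ M₁ t).union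
    ((isCompact_checkerboard_part (f := fun _ => -1 + P) (g := fun T => T) (h := fun _ => 1 - P)
      (by fun_prop) (by fun_prop) (by fun_prop) ?_ M₂ t).union
    (isCompact_checkerboard_part (f := fun T => -2 + P + T) (g := fun _ => -1 + P) (h := fun T => T)
      (by fun_prop) (by fun_prop) (by fun_prop) ?_ M₃ t)) <;>
  · rintro T ⟨_, _⟩
    refine ⟨⟨?_, ?_⟩, ⟨?_, ?_⟩, ⟨?_, ?_⟩⟩ <;> linarith

/-- The continuous image of a compact set in a Hausdorff quotient. -/
lemma isClosed_piece {P : ℝ} (hP₀ : 0 < P) (hP₁ : P < 1) (t : OrientedTile) :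
    IsClosed (piece P t) := by
  refine (IsCompact.image ?_ QuotientAddGroup.continuous_mk).isClosed
  refine (isCompact_basePiece hP₀ hP₁ t).union ?_
  exact (Homeomorph.subRight ((2, P, P) : ℝ × ℝ × ℝ)).isCompact_preimage.2
    (isCompact_basePiece hP₀ hP₁ t.reverse)

/-! ### The pieces cover the torus -/

lemma exists_mem_cut {u : Fin 3 → ℝ} {U : ℝ} (h₀ : -1 ≤ U) (h₁ : U ≤ 1) :
    ∃ j : Fin 4, U ∈ Set.Icc (cut u j.castSucc) (cut u j.succ) := by
  rcases le_total U (u 0) with h | h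
  · exact ⟨0, h₀, h⟩
  rcases le_total U (u 1) with h' | h'
  · exact ⟨1, h, h'⟩
  rcases le_total U (u 2) with h'' | h''
  · exact ⟨2, h', h''⟩
  · exact ⟨3, h'', h₁⟩

lemma exists_mem_checkerboard {u : Fin 3 → ℝ} {M : Fin 4 → Fin 4 → Option Side} {s : Fin 4 → Side}
    (hM : SymbolsGivenBy M s) {z : ℝ × ℝ} (h₁ : -1 ≤ z.1) (h₁' : z.1 ≤ 1) (h₂ : -1 ≤ z.2)
    (h₂' : z.2 ≤ 1) : ∃ t, z ∈ checkerboard u M t := by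
  obtain ⟨j, hj⟩ := exists_mem_cut (u := u) h₁ h₁'
  obtain ⟨i, hi⟩ := exists_mem_cut (u := u) h₂ h₂'
  exact ⟨_, i.rev, j, (hM.hasLabel_iff _ _ _).2 rfl, hj, by rwa [Fin.rev_rev]⟩

lemma exists_mem_basePiece (P : ℝ) {v : ℝ × ℝ × ℝ} (hT : -1 ≤ v.1) (hT' : v.1 ≤ 1)
    (h₁ : -1 ≤ v.2.1) (h₁' : v.2.1 ≤ 1) (h₂ : -1 ≤ v.2.2) (h₂' : v.2.2 ≤ 1) :
    ∃ t, v ∈ basePiece P t := by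
  rcases le_total v.1 (-1 + P) with h | h
  · exact (exists_mem_checkerboard symbolsGivenBy₁ h₁ h₁' h₂ h₂').imp
      fun _ ht => .inl ⟨⟨hT, h⟩, ht⟩
  rcases le_total v.1 (1 - P) with h' | h'
  · exact (exists_mem_checkerboard symbolsGivenBy₂ h₁ h₁' h₂ h₂').imp
      fun _ ht => .inr (.inl ⟨⟨h, h'⟩, ht⟩)
  · exact (exists_mem_checkerboard symbolsGivenBy₃ h₁ h₁' h₂ h₂').imp
      fun _ ht => .inr (.inr ⟨⟨h', hT'⟩, ht⟩)

lemma exists_int_reduce (x : ℝ) : ∃ n : ℤ, -1 ≤ x - 2 * n ∧ x - 2 * n ≤ 1 := by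
  refine ⟨⌊(x + 1) / 2⌋, ?_, ?_⟩
  · linarith [Int.floor_le ((x + 1) / 2)]
  · linarith [Int.lt_floor_add_one ((x + 1) / 2)]

lemma exists_proj_mem_piece (P : ℝ) (v : ℝ × ℝ × ℝ) : ∃ t, proj P v ∈ piece P t := by
  obtain ⟨k, hk, hk'⟩ := exists_int_reduce v.1
  obtain ⟨b, hb, hb'⟩ := exists_int_reduce (v.2.1 - k * P)
  obtain ⟨c, hc, hc'⟩ := exists_int_reduce (v.2.2 - k * P)
  obtain ⟨t, ht⟩ := exists_mem_basePiece P
    (v := (v.1 - 2 * k, v.2.1 - k * P - 2 * b, v.2.2 - k * P - 2 * c)) hk hk' hb hb' hc hc'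
  -- `k` counts translations by (2, P, P): an even number is a lattice vector up to the periods, an
  -- odd number lands in the reversed cube.
  obtain ⟨a, rfl | rfl⟩ := Int.even_or_odd' k
  · refine ⟨t, _, .inl ht, QuotientAddGroup.eq.2 (mem_orientedLattice.2 ⟨a, b, c, ?_⟩)⟩
    refine Prod.ext ?_ (Prod.ext ?_ ?_) <;> simp <;> ring
  · set w : ℝ × ℝ × ℝ := (v.1 - 2 * ((2 * a + 1 : ℤ) : ℝ),
      v.2.1 - ((2 * a + 1 : ℤ) : ℝ) * P - 2 * b, v.2.2 - ((2 * a + 1 : ℤ) : ℝ) * P - 2 * c) with hw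
    refine ⟨t.reverse, w + (2, P, P), .inr ?_,
      QuotientAddGroup.eq.2 (mem_orientedLattice.2 ⟨a, b, c, ?_⟩)⟩
    · change w + (2, P, P) - (2, P, P) ∈ basePiece P t.reverse.reverse
      rwa [add_sub_cancel_right, OrientedTile.reverse_reverse]
    · refine Prod.ext ?_ (Prod.ext ?_ ?_) <;> simp [hw] <;> ring

instance : Finite OrientedTile :=
  Finite.of_injective
    (fun t : OrientedTile => match t with
      | .empty => (none : Option (Side × Side))
      | .connector a b _ => some (a, b)) <| by
    rintro (_ | ⟨a, b, _⟩) (_ | ⟨a', b', _⟩) h <;> simp_all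

/-- The complement of the other pieces is an open neighbourhood of the point, and by covering it is
contained in the one remaining piece. -/
lemma Generic.proj_mem_interior {P : ℝ} (hP₀ : 0 < P) (hP₁ : P < 1) {v : ℝ × ℝ × ℝ}
    (hv : Generic P v) : ∃ t, proj P v ∈ interior (piece P t) := by
  obtain ⟨t, ht⟩ := exists_proj_mem_piece P v
  refine ⟨t, mem_interior.2 ⟨(⋃ t' : {t' // t' ≠ t}, piece P t')ᶜ, ?_, ?_, ?_⟩⟩
  · intro x hx
    obtain ⟨w, rfl⟩ := QuotientAddGroup.mk_surjective x
    obtain ⟨t', ht'⟩ := exists_proj_mem_piece P w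
    by_contra h
    exact hx (Set.mem_iUnion.2 ⟨⟨t', fun e => h (e ▸ ht')⟩, ht'⟩)
  · exact (isClosed_iUnion_of_finite fun t' => isClosed_piece hP₀ hP₁ _).isOpen_compl
  · intro h
    obtain ⟨⟨t', hne⟩, ht'⟩ := Set.mem_iUnion.1 h
    exact hne ((describes_of_proj_mem_piece hP₀ hP₁ hv ht').unique
      (describes_of_proj_mem_piece hP₀ hP₁ hv ht))

/-! ### Almost every point is generic -/

/-- A level set is a translate of the kernel, a proper subspace, hence null. -/
lemma ae_linear_ne {f : ℝ × ℝ × ℝ →ₗ[ℝ] ℝ} (hf : f ≠ 0) (c : ℝ) :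
    ∀ᵐ v ∂(volume : Measure (ℝ × ℝ × ℝ)), f v ≠ c := by
  have : (volume : Measure (ℝ × ℝ × ℝ)).IsAddHaarMeasure :=
    Measure.prod.instIsAddHaarMeasure (volume : Measure ℝ) (volume : Measure (ℝ × ℝ))
  obtain ⟨v₀, rfl⟩ := LinearMap.surjective hf c
  have h := Measure.addHaar_submodule (volume : Measure (ℝ × ℝ × ℝ)) f.ker
    (by rwa [Ne, LinearMap.ker_eq_top])
  rw [← measure_preimage_add_right _ (-v₀)] at h
  rw [ae_iff]
  convert h using 2
  ext v
  simp [← sub_eq_add_neg, sub_eq_zero]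

lemma ae_forall_int_ne (P : ℝ) : ∀ᵐ v ∂(volume : Measure (ℝ × ℝ × ℝ)), ∀ a b : ℤ,
    (v.2.1 ≠ a * P + b ∧ v.2.2 ≠ a * P + b) ∧
      v.2.1 - v.1 ≠ a * P + b ∧ v.2.2 - v.1 ≠ a * P + b := by
  simp only [ae_all_iff]
  intro a b
  let p₀ : ℝ × ℝ × ℝ →ₗ[ℝ] ℝ := .fst ℝ ℝ (ℝ × ℝ)
  let p₁ : ℝ × ℝ × ℝ →ₗ[ℝ] ℝ := .fst ℝ ℝ ℝ ∘ₗ .snd ℝ ℝ (ℝ × ℝ)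
  let p₂ : ℝ × ℝ × ℝ →ₗ[ℝ] ℝ := .snd ℝ ℝ ℝ ∘ₗ .snd ℝ ℝ (ℝ × ℝ)
  have h₁ : p₁ ≠ 0 := fun h => by simpa [p₁] using LinearMap.congr_fun h (0, 1, 0)
  have h₂ : p₂ ≠ 0 := fun h => by simpa [p₂] using LinearMap.congr_fun h (0, 0, 1)
  have h₃ : p₁ - p₀ ≠ 0 := fun h => by simpa [p₁, p₀] using LinearMap.congr_fun h (0, 1, 0)
  have h₄ : p₂ - p₀ ≠ 0 := fun h => by simpa [p₂, p₀] using LinearMap.congr_fun h (0, 0, 1)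
  filter_upwards [ae_linear_ne h₁ (a * P + b), ae_linear_ne h₂ (a * P + b),
    ae_linear_ne h₃ (a * P + b), ae_linear_ne h₄ (a * P + b)] with v h1 h2 h3 h4
  exact ⟨⟨h1, h2⟩, h3, h4⟩

lemma dense_generic (P : ℝ) : Dense {v | Generic P v} := by
  refine Measure.dense_of_ae (μ := (volume : Measure (ℝ × ℝ × ℝ))) ?_
  filter_upwards [ae_forall_int_ne P] with v hv
  refine ⟨fun a b => ⟨fun e => (hv a (2 * b + 1)).1.1 ?_, fun e => (hv a (2 * b)).2.1 ?_⟩,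
    fun a b => ⟨fun e => (hv a (2 * b + 1)).1.2 ?_, fun e => (hv a (2 * b)).2.2 ?_⟩⟩ <;>
    (push_cast; linarith)

/-! ### Tilings -/

/-- A lift of the image of the centre of the square `[m, m + 1] × [n, n + 1]`. -/
def centre (P : ℝ) (V : ℝ × ℝ × ℝ) (m n : ℤ) : ℝ × ℝ × ℝ :=
  (2 * P * (m + 1 / 2) + 2 * (n + 1 / 2), 2 * P * (m + 1 / 2),
    2 * P * (m + 1 / 2) + 2 * P * (n + 1 / 2)) + V

/-- Both conditions are open in the base point, so a dense generic set meets them simultaneously.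
With s = 0 this gives uniqueness of the tile, with s a step to a neighbour it gives matching. -/
lemma exists_generic_describes {P : ℝ} (hP₀ : 0 < P) (hP₁ : P < 1) {v s : ℝ × ℝ × ℝ}
    (hs : ∀ v, Generic P v → Generic P (v + s)) {t t' : OrientedTile}
    (h : proj P v ∈ interior (piece P t)) (h' : proj P (v + s) ∈ interior (piece P t')) :
    ∃ w, Describes P w t ∧ Describes P (w + s) t' := by
  have hopen : IsOpen ({w | proj P w ∈ interior (piece P t)} ∩
      {w | proj P (w + s) ∈ interior (piece P t')}) :=
    (isOpen_interior.preimage QuotientAddGroup.continuous_mk).inter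
      (isOpen_interior.preimage
        (QuotientAddGroup.continuous_mk.comp (continuous_id.add continuous_const)))
  obtain ⟨w, ⟨hw, hw'⟩, hg⟩ := (dense_generic P).inter_open_nonempty _ hopen ⟨v, h, h'⟩
  exact ⟨w, describes_of_proj_mem_piece hP₀ hP₁ hg (interior_subset hw),
    describes_of_proj_mem_piece hP₀ hP₁ (hs w hg) (interior_subset hw')⟩

lemma AssignsTile.unique {P : ℝ} (hP₀ : 0 < P) (hP₁ : P < 1) {V : ℝ × ℝ × ℝ} {m n : ℤ}
    {t t' : OrientedTile} (h : AssignsTile P V m n t) (h' : AssignsTile P V m n t') : t = t' := by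
  obtain ⟨w, hw, hw'⟩ := exists_generic_describes (v := centre P V m n) (s := 0) hP₀ hP₁
    (fun v hv => by rwa [add_zero]) h (by rw [add_zero]; exact h')
  rw [add_zero] at hw'
  exact hw.unique hw'

lemma Produces.coherentlyOriented {P : ℝ} (hP₀ : 0 < P) (hP₁ : P < 1) {V : ℝ × ℝ × ℝ}
    {τ : ℤ → ℤ → OrientedTile} (h : Produces P V τ) : CoherentlyOriented τ := by
  intro m n
  constructor
  · have e : centre P V m n + (2, 0, 2 * P) = centre P V m (n + 1) := by
      refine Prod.ext ?_ (Prod.ext ?_ ?_) <;> simp [centre] <;> ring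
    obtain ⟨w, hw, hw'⟩ := exists_generic_describes (v := centre P V m n) (s := (2, 0, 2 * P))
      hP₀ hP₁ (fun v hv => by simpa using hv.translate 0 0 2 0 0 1) (h m n) (by
        rw [e]; exact h m (n + 1))
    exact match_north_of_describes hw hw'
  · have e : centre P V m n + (2 * P, 2 * P, 2 * P) = centre P V (m + 1) n := by
      refine Prod.ext ?_ (Prod.ext ?_ ?_) <;> simp [centre] <;> ring
    obtain ⟨w, hw, hw'⟩ := exists_generic_describes (v := centre P V m n)
      (s := (2 * P, 2 * P, 2 * P))
      hP₀ hP₁ (fun v hv => by simpa using hv.translate 2 0 2 0 2 0) (h m n) (by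
        rw [e]; exact h (m + 1) n)
    exact match_east_of_describes hw hw'

lemma goodOffset_of_generic {P : ℝ} (hP₀ : 0 < P) (hP₁ : P < 1) {V : ℝ × ℝ × ℝ}
    (h : ∀ m n, Generic P (centre P V m n)) : GoodOffset P V :=
  fun m n => (h m n).proj_mem_interior hP₀ hP₁

/-- The coordinates of the centres relative to V lie in Pℤ + ℤ, so one countable family of planes
for V serves all squares. -/
lemma ae_goodOffset {P : ℝ} (hP₀ : 0 < P) (hP₁ : P < 1) :
    ∀ᵐ V ∂(volume : Measure (ℝ × ℝ × ℝ)), GoodOffset P V := by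
  filter_upwards [ae_forall_int_ne P] with V hV
  refine goodOffset_of_generic hP₀ hP₁ fun m n => ⟨fun a b => ⟨fun e => ?_, fun e => ?_⟩,
    fun a b => ⟨fun e => ?_, fun e => ?_⟩⟩ <;> simp only [centre, Prod.fst_add, Prod.snd_add] at e
  · apply (hV (a - (2 * m + 1)) (2 * b + 1)).1.1
    push_cast; linarith
  · apply (hV a (2 * b + (2 * n + 1))).2.1
    push_cast; linarith
  · apply (hV (a - (2 * m + 1) - (2 * n + 1)) (2 * b + 1)).1.2
    push_cast; linarith
  · apply (hV (a - (2 * n + 1)) (2 * b + (2 * n + 1))).2.2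
    push_cast; linarith

/-- Clearing the denominator gives 2ap = b(p + q), even on the left and odd on the right. -/
lemma int_mul_ne_odd {p q : ℕ} (hp : 0 < p) (hpq : Odd (p + q)) (a : ℤ) {b : ℤ} (hb : Odd b) :
    a * (2 * (p : ℝ) / ((p : ℝ) + (q : ℝ))) ≠ b := by
  intro e
  have hs : (p : ℝ) + q ≠ 0 := by positivity
  field_simp at e
  have e' : a * 2 * (p : ℤ) = b * (p + q : ℕ) := by
    push_cast; exact_mod_cast (by linarith : (a : ℝ) * 2 * p = b * (p + q))
  have h : Odd (b * ((p + q : ℕ) : ℤ)) := hb.mul (by exact_mod_cast hpq)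
  rw [← e', ← Int.not_even_iff_odd] at h
  exact h ⟨a * p, by ring⟩

lemma goodOffset_zero {p q : ℕ} (hp : 0 < p) (hq : p < q) (hpq : Odd (p + q)) :
    GoodOffset (2 * (p : ℝ) / ((p : ℝ) + (q : ℝ))) 0 := by
  have hp' : (0 : ℝ) < p := by exact_mod_cast hp
  have hq' : (p : ℝ) < q := by exact_mod_cast hq
  have key := fun a b hb => int_mul_ne_odd hp hpq a (b := b) hb
  have hP₁ : 2 * (p : ℝ) / ((p : ℝ) + (q : ℝ)) < 1 := by rw [div_lt_one] <;> linarith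
  have hP₀ : 0 < 2 * (p : ℝ) / ((p : ℝ) + (q : ℝ)) := by positivity
  generalize 2 * (p : ℝ) / ((p : ℝ) + (q : ℝ)) = P at *
  refine goodOffset_of_generic hP₀ hP₁ fun m n => ⟨fun a b => ⟨fun e => ?_, fun e => ?_⟩,
    fun a b => ⟨fun e => ?_, fun e => ?_⟩⟩ <;> simp only [centre, add_zero] at e
  · apply key (2 * m + 1 - a) (2 * b + 1) ⟨b, rfl⟩
    push_cast; linarith
  · apply key (-a) (2 * (n + b) + 1) ⟨_, rfl⟩
    push_cast; linarith
  · apply key (2 * m + 1 + (2 * n + 1) - a) (2 * b + 1) ⟨b, rfl⟩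
    push_cast; linarith
  · apply key (2 * n + 1 - a) (2 * (n + b) + 1) ⟨_, rfl⟩
    push_cast; linarith

end Plaid

end

theorem mainTheorem8 :
    (∀ P : ℝ, 0 < P → P < 1 →
      (∀ᵐ V ∂(volume : Measure (ℝ × ℝ × ℝ)), Plaid.GoodOffset P V) ∧
      (∀ V : ℝ × ℝ × ℝ, Plaid.GoodOffset P V →
        (∃! τ : ℤ → ℤ → Plaid.OrientedTile, Plaid.Produces P V τ) ∧
        ∀ τ : ℤ → ℤ → Plaid.OrientedTile, Plaid.Produces P V τ → Plaid.CoherentlyOriented τ)) ∧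
    (∀ p q : ℕ, 0 < p → p < q → p.Coprime q → Even (p * q) →
      Plaid.GoodOffset (2 * (p : ℝ) / ((p : ℝ) + (q : ℝ))) 0) := by
  refine ⟨fun P hP₀ hP₁ => ⟨Plaid.ae_goodOffset hP₀ hP₁, fun V hV => ⟨?_, fun τ hτ =>
    hτ.coherentlyOriented hP₀ hP₁⟩⟩, fun p q hp hq hc he => Plaid.goodOffset_zero hp hq ?_⟩
  · choose τ hτ using hV
    exact ⟨τ, hτ, fun τ' hτ' => funext₂ fun m n => (hτ' m n).unique hP₀ hP₁ (hτ m n)⟩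
  -- Coprimality excludes that both are even, and pq even that both are odd, so p + q is odd.
  · rw [Nat.odd_add]
    rw [Nat.even_mul] at he
    have : ¬ (Even p ∧ Even q) := fun ⟨h, h'⟩ =>
      Nat.not_coprime_of_dvd_of_dvd one_lt_two h.two_dvd h'.two_dvd hc
    rw [← Nat.not_even_iff_odd]
    tauto
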